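/- Let $K$ be an algebraically closed field of characteristic $0$. Let $\operatorname{Rat}_2^2\cong\mathbb P^{17}$ be the projective space of triples $f=[f_0,f_1,f_2]\neq 0$ of quadratic forms in $X,Y,Z$ over $K$, up to scaling; each $f$ defines a rational map $f:\mathbb P^2\dashrightarrow\mathbb P^2$. The group $\operatorname{PGL}_3(K)$ acts on $\operatorname{Rat}_2^2$ by $f^\varphi=\varphi^{-1}\circ f\circ\varphi$, and $\operatorname{Aut}(f)=\{\varphi\in\operatorname{PGL}_3(K): f^\varphi=f\}$. For a finite subgroup $\mathcal G\subset\operatorname{PGL}_3(K)$, let $\operatorname{Rat}_2^2(\mathcal G)=\{f:\operatorname{Aut}(f)\supseteq\mathcal G\}$, and let $\operatorname{Rat}_2^2(\mathcal G)^{ss}$ be the set of those $f\in\operatorname{Rat}_2^2(\mathcal G)$ that are $N(\mathcal G)$-semistable, i.e. such that $0$ is not in the Zariski closure of the orbit of a lift $(f_0,f_1,f_2)$ of $f$ under conjugation by the group of those matrices in $\operatorname{SL}_3(K)$ whose class in $\operatorname{PGL}_3(K)$ normalizes $\mathcal G$. Let $\mathcal G\subset\operatorname{PGL}_3(K)$ be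 a finite subgroup with $\#\mathcal G\ge 3$. Suppose that there exists $f\in\operatorname{Rat}_2^2(\mathcal G)^{ss}$ such that $f:\mathbb P^2\dashrightarrow\mathbb P^2$ is dominant, $\deg(f)=2$ (that is, $f_0,f_1,f_2$ have no non-constant common factor), and $\operatorname{Aut}(f)$ is finite. Then $\mathcal G$ contains a subgroup that is $\operatorname{PGL}_3(K)$-conjugate to one of the following groups, where $\zeta_n$ is a primitive $n$-th root of unity and $i=\zeta_4$: $$\mathcal G_3=\langle\operatorname{diag}(1,\zeta_3,\zeta_3^2)\rangle,\quad \mathcal G_4=\langle\operatorname{diag}(1,i,-1)\rangle,\quad \mathcal G_5=\langle\operatorname{diag}(1,\zeta_5,\zeta_5^3)\rangle,\quad \mathcal G_7=\langle\operatorname{diag}(1,\zeta_7,\zeta_7^3)\rangle,$$ $$\mathcal G_{2,2}=\langle\operatorname{diag}(1,-1,1),\ \operatorname{diag}(1,1,-1)\rangle.$$ More precisely, every subgroup of $\mathcal G$ whose order is $4$ or an odd prime is $\operatorname{PGL}_3(K)$-conjugate to one of these groups. In particular, $\mathcal G$ itself is conjugate to one of them if $\#\mathcal G$ is $4$ or an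 odd prime. -/

import Mathlib

open scoped MatrixGroups LinearAlgebra.Projectivization

noncomputable section

namespace RationalMap

open MvPolynomial

variable {K : Type*} [Field K] {n d : ℕ}

/-- The affine cone over the parameter space: `n`-tuples of forms of degree `d` in `n` variables. -/
abbrev FormTuple (n d : ℕ) (K : Type*) [Field K] : Type _ := Fin n → homogeneousSubmodule (Fin n) K d

/-- The parameter space `Rat_d^{n-1} = ℙ^L` of rational self-maps of `ℙ^{n-1}` of formal degree `d`
(`n` is the number of homogeneous coordinates). -/
abbrev RatSpace (n d : ℕ) (K : Type*) [Field K] : Type _ := ℙ K (FormTuple n d K)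

/-- The linear substitution `p ↦ p ∘ A`, that is, `p(x) ↦ p(A x)`. -/
def subst (A : GL (Fin n) K) :
    MvPolynomial (Fin n) K →ₐ[K] MvPolynomial (Fin n) K :=
  aeval fun i => ∑ j, C ((A : Matrix (Fin n) (Fin n) K) i j) * X j

lemma subst_X (A : GL (Fin n) K) (i : Fin n) :
    subst A (X i) = ∑ j, C ((A : Matrix (Fin n) (Fin n) K) i j) * X j := by
  simp [subst]

lemma subst_one (p : MvPolynomial (Fin n) K) : subst 1 p = p := by
  have h : subst (K := K) (n := n) 1 = AlgHom.id K _ := by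
    ext i : 1
    simp [subst_X, Matrix.one_apply]
  simp [h]

lemma subst_mul (A B : GL (Fin n) K) (p : MvPolynomial (Fin n) K) :
    subst (A * B) p = subst B (subst A p) := by
  have h : subst (A * B) = (subst B).comp (subst A) := by
    ext i : 1
    simp only [AlgHom.comp_apply, subst_X, map_sum, map_mul, algHom_C, algebraMap_eq,
      Units.val_mul, Matrix.mul_apply, Finset.sum_mul, Finset.mul_sum]
    rw [Finset.sum_comm]
    simp only [mul_assoc]
  simp [h]

lemma subst_isHomogeneous (A : GL (Fin n) K) {p : MvPolynomial (Fin n) K}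
    (hp : p.IsHomogeneous d) : (subst A p).IsHomogeneous d := by
  have h := hp.aeval (fun i => ∑ j, C ((A : Matrix (Fin n) (Fin n) K) i j) * X j)
    (n := 1) (fun i => IsHomogeneous.sum _ _ _ fun j _ => isHomogeneous_C_mul_X _ _)
  simpa [subst] using h

/-- The conjugate `A⁻¹ ∘ F ∘ A` of a tuple of forms. -/
def conj (A : GL (Fin n) K) : FormTuple n d K →ₗ[K] FormTuple n d K where
  toFun F i := ∑ j, ((A⁻¹ : GL (Fin n) K) : Matrix (Fin n) (Fin n) K) i j •
    (⟨subst A (F j), subst_isHomogeneous A (F j).2⟩ : homogeneousSubmodule (Fin n) K d)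
  map_add' F G := by
    ext i : 2
    simp [smul_add, Finset.sum_add_distrib]
  map_smul' c F := by
    ext i : 2
    simp [Finset.smul_sum, smul_comm c]

lemma coe_conj (A : GL (Fin n) K) (F : FormTuple n d K) (i : Fin n) :
    (conj A F i : MvPolynomial (Fin n) K) =
      ∑ j, ((A⁻¹ : GL (Fin n) K) : Matrix (Fin n) (Fin n) K) i j •
        subst A (F j : MvPolynomial (Fin n) K) := by
  simp [conj]

lemma conj_one (F : FormTuple n d K) : conj 1 F = F := by
  funext i
  apply Subtype.ext
  simp [coe_conj, subst_one, Matrix.one_apply]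

lemma conj_mul (A B : GL (Fin n) K) (F : FormTuple n d K) :
    conj (A * B) F = conj B (conj A F) := by
  funext i
  apply Subtype.ext
  simp only [coe_conj, mul_inv_rev, Units.val_mul, Matrix.mul_apply, subst_mul, map_sum, map_smul,
    Finset.sum_smul, Finset.smul_sum, smul_smul]
  rw [Finset.sum_comm]

lemma conj_injective (A : GL (Fin n) K) :
    Function.Injective (conj A : FormTuple n d K →ₗ[K] FormTuple n d K) := by
  intro F G h
  have := congrArg (conj A⁻¹) h
  simpa [← conj_mul, conj_one] using this

/-- The conjugate `f^φ = φ⁻¹ ∘ f ∘ φ` of a point of the parameter space by the class `φ` of a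
matrix `A`. -/
def conjRat (A : GL (Fin n) K) (f : RatSpace n d K) : RatSpace n d K :=
  f.map (conj A) (conj_injective A)

lemma conjRat_one (f : RatSpace n d K) : conjRat 1 f = f := by
  induction f using Projectivization.ind with
  | h F hF => simp [conjRat, Projectivization.map_mk, conj_one]

lemma conjRat_mul (A B : GL (Fin n) K) (f : RatSpace n d K) :
    conjRat (A * B) f = conjRat B (conjRat A f) := by
  induction f using Projectivization.ind with
  | h F hF => simp [conjRat, Projectivization.map_mk, conj_mul]

/-- The automorphism group `Aut(f) = {φ ∈ PGL_n : f^φ = f}`, as the image in `PGL_n` of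
the group of all matrices whose class fixes `f`. -/
def Aut (f : RatSpace n d K) : Subgroup PGL(n, K) :=
  Subgroup.map Matrix.ProjGenLinGroup.mk
    { carrier := {A | conjRat A f = f}
      mul_mem' := fun {A B} hA hB => by
        simp only [Set.mem_ofPred_eq] at hA hB ⊢
        rw [conjRat_mul, hA, hB]
      one_mem' := conjRat_one f
      inv_mem' := fun {A} hA => by
        simp only [Set.mem_ofPred_eq] at hA ⊢
        conv_lhs => rw [← hA]
        rw [← conjRat_mul, mul_inv_cancel, conjRat_one] }

/-- The coordinates on the affine cone: all the coefficients of the forms of a tuple. -/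
def coords (F : FormTuple n d K) : Fin n × {m : Fin n →₀ ℕ // m.degree = d} → K :=
  fun a => coeff a.2.1 (F a.1 : MvPolynomial (Fin n) K)

/-- Semistability of `f` for the conjugation action of a subgroup `S` of `SL_n`: the vertex `0`
of the affine cone is not in the Zariski closure of the `S`-orbit of a lift of `f`. -/
def IsSemistable (S : Subgroup SL(n, K)) (f : RatSpace n d K) : Prop :=
  (0 : Fin n × {m : Fin n →₀ ℕ // m.degree = d} → K) ∉
    zeroLocus K (vanishingIdeal K {v | ∃ A ∈ S, v = coords (conj A.toGL f.rep)})

/-- The normalizer of a subgroup `G` of `PGL_n`, lifted to `SL_n`. -/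
def liftedNormalizer (G : Subgroup PGL(n, K)) : Subgroup SL(n, K) :=
  (Subgroup.normalizer (G : Set PGL(n, K))).comap Matrix.SpecialLinearGroup.toPGL

variable (n d) in
/-- `Rat_d^{n-1}(G)`: the points of the parameter space whose automorphism group contains `G`. -/
def RatWith (G : Subgroup PGL(n, K)) : Set (RatSpace n d K) := {f | G ≤ Aut f}

variable (n d) in
/-- `Rat_d^{n-1}(G)^ss`: the `N(G)`-semistable points of `Rat_d^{n-1}(G)`. -/
def RatWithSS (G : Subgroup PGL(n, K)) : Set (RatSpace n d K) :=
  {f | f ∈ RatWith n d G ∧ IsSemistable (liftedNormalizer G) f}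

/-- The value of (a lift of) `f` at a vector `x`. It is zero exactly if the forms vanish at `x`. -/
def value (f : RatSpace n d K) (x : Fin n → K) : Fin n → K :=
  fun i => eval x (f.rep i : MvPolynomial (Fin n) K)

/-- The rational map `f : ℙ^{n-1} ⇢ ℙ^{n-1}` is dominant: its image is Zariski dense, that is, a form that
vanishes at all values of `f` is zero (for `K` infinite). -/
def IsDominant (f : RatSpace n d K) : Prop :=
  ∀ (k : ℕ) (P : MvPolynomial (Fin n) K), P.IsHomogeneous k →
    (∀ x, value f x ≠ 0 → eval (value f x) P = 0) → P = 0

/-- The rational map `f : ℙ^{n-1} ⇢ ℙ^{n-1}` has degree `e`: after a common factor `H` of its coordinate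
forms is cancelled, the forms have degree `e` and no non-constant common factor. -/
def HasDegree (f : RatSpace n d K) (e : ℕ) : Prop :=
  ∃ (H : MvPolynomial (Fin n) K) (F' : Fin n → MvPolynomial (Fin n) K),
    (∀ i, (f.rep i : MvPolynomial (Fin n) K) = H * F' i) ∧
    (∀ i, (F' i).IsHomogeneous e) ∧
    ∀ D : MvPolynomial (Fin n) K, (∀ i, D ∣ F' i) → IsUnit D

/-- The class in `PGL_3(K)` of the diagonal matrix `diag(a, b, c)`. -/
def diag (a b c : Kˣ) : PGL(3, K) :=
  Matrix.ProjGenLinGroup.mk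
    { val := Matrix.diagonal ![(a : K), b, c]
      inv := Matrix.diagonal ![((a⁻¹ : Kˣ) : K), (b⁻¹ : Kˣ), (c⁻¹ : Kˣ)]
      val_inv := by
        rw [Matrix.diagonal_mul_diagonal, ← Matrix.diagonal_one]
        congr 1
        funext i
        fin_cases i <;> simp
      inv_val := by
        rw [Matrix.diagonal_mul_diagonal, ← Matrix.diagonal_one]
        congr 1
        funext i
        fin_cases i <;> simp }

/-- `G` is `PGL_3(K)`-conjugate to `H`. -/
def IsConjSubgroup (G H : Subgroup PGL(3, K)) : Prop :=
  ∃ φ : PGL(3, K), G.map (MulAut.conj φ).toMonoidHom = H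

/-- `G` is `PGL_3(K)`-conjugate to `G_3`, `G_4`, `G_5`, `G_7` or `G_{2,2}`. -/
def IsConjToListed (ζ₃ ζ₄ ζ₅ ζ₇ : Kˣ) (G : Subgroup PGL(3, K)) : Prop :=
  IsConjSubgroup G (Subgroup.closure {diag 1 ζ₃ (ζ₃ ^ 2)}) ∨
  IsConjSubgroup G (Subgroup.closure {diag 1 ζ₄ (-1)}) ∨
  IsConjSubgroup G (Subgroup.closure {diag 1 ζ₅ (ζ₅ ^ 3)}) ∨
  IsConjSubgroup G (Subgroup.closure {diag 1 ζ₇ (ζ₇ ^ 3)}) ∨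
  IsConjSubgroup G (Subgroup.closure {diag 1 (-1) 1, diag 1 1 (-1)})

end RationalMap

end

/-!
Conjugation by a scalar matrix `c` multiplies a tuple of *quadratic* forms by `c`. Hence every
automorphism of `f` has exactly one lift to `GL₃` that fixes the chosen tuple `F` itself
(`liftAut`), and a subgroup of `Aut f` lifts isomorphically to a group of matrices commuting with
`F`. A subgroup `H` of order `4` or of prime order is commutative, so after a change of coordinates
its lift is diagonal (`exists_diagonalization`). If `diag(u₀, u₁, u₂)` commutes with `F`, then
`x_j x_k` can occur in `F_i` only if `u_j u_k = u_i`.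

Two consequences of the hypotheses on `f` restrict these relations (`IsRigid`,
`isRigid_of_conj_eq`). Since `Aut f` is finite, no nonzero integral weight vector is compatible with
all relations that hold: otherwise a one-parameter group of diagonal matrices would fix `F`. Since
`f` is dominant, the `F_i` are linearly independent, so none of them is zero and no two are
multiples of the same square.

Write `u_i = ζ ^ e_i`. If `H` is not of exponent `2`, the `e_i` are pairwise distinct
(`IsRigid.not_zero_eq_one`). For order `4` this already gives `G₄`, since three distinct residues
modulo `4` are consecutive up to order. For an odd prime `p`, either some `e_i` vanishes, which
forces `p = 3` (`IsRigid.eq_three`), or every form needs a monomial free of its own variable, and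
this forces `e`, up to order, to be proportional to `(1, 2, 4)` with `p = 5` or `p = 7`
(`IsRigid.eq_five_or_seven`). A group of order `4` and exponent `2` becomes the group of all
diagonal classes with entries `±1`, which is `G₂,₂`. Finally, every finite group of order at least
`3` has a subgroup of order `4` or of odd prime order, by Sylow's theorem.
-/

noncomputable section

namespace RationalMap

open MvPolynomial

/-! ### Diagonal coordinate changes -/

section Diagonal

variable {K : Type*} [Field K] {n d : ℕ}

/-- The invertible diagonal matrix with the given entries, as a homomorphism from the torus. -/
def diagGL (n : ℕ) (K : Type*) [Field K] : (Fin n → Kˣ) →* GL (Fin n) K :=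
  (Units.map (Matrix.diagonalRingHom (Fin n) K : (Fin n → K) →* Matrix (Fin n) (Fin n) K)).comp
    (MulEquiv.piUnits (M := fun _ : Fin n => K)).symm.toMonoidHom

lemma coe_diagGL (u : Fin n → Kˣ) :
    (diagGL n K u : Matrix (Fin n) (Fin n) K) = Matrix.diagonal fun i => (u i : K) := rfl

lemma diagGL_injective : Function.Injective (diagGL n K) := fun u v h => by
  funext i
  have := congrArg (fun A : GL (Fin n) K => (A : Matrix (Fin n) (Fin n) K) i i) h
  simpa [coe_diagGL, Units.ext_iff] using this

lemma diagGL_const (c : Kˣ) : diagGL n K (fun _ => c) = Matrix.GeneralLinearGroup.scalar (Fin n) c := by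
  ext i j
  simp [coe_diagGL, Matrix.GeneralLinearGroup.coe_scalar, Matrix.scalar_apply]

lemma subst_diagGL_monomial (u : Fin n → Kˣ) (m : Fin n →₀ ℕ) (a : K) :
    subst (diagGL n K u) (monomial m a) = monomial m ((∏ j, (u j : K) ^ m j) * a) := by
  have h : ∀ i, ∑ j, C ((diagGL n K u : Matrix (Fin n) (Fin n) K) i j) * X j
      = C (u i : K) * (X i : MvPolynomial (Fin n) K) := by
    intro i
    rw [Finset.sum_eq_single i]
    · simp [coe_diagGL]
    · intro j _ hj
      simp [coe_diagGL, Matrix.diagonal_apply_ne _ hj.symm]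
    · simp
  rw [subst, aeval_monomial, Finsupp.prod_fintype _ _ (by simp)]
  simp only [h, mul_pow, Finset.prod_mul_distrib, ← C_pow, ← map_prod, algebraMap_eq]
  rw [monomial_eq, Finsupp.prod_fintype _ _ (by simp), C_mul]
  ring

lemma coeff_subst_diagGL (u : Fin n → Kˣ) (p : MvPolynomial (Fin n) K) (m : Fin n →₀ ℕ) :
    coeff m (subst (diagGL n K u) p) = (∏ j, (u j : K) ^ m j) * coeff m p := by
  induction p using MvPolynomial.induction_on' with
  | monomial k a =>
    rw [subst_diagGL_monomial, coeff_monomial, coeff_monomial]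
    split_ifs with h
    · rw [h]
    · simp
  | add p q hp hq => rw [map_add, coeff_add, coeff_add, hp, hq, mul_add]

lemma coeff_conj_diagGL (u : Fin n → Kˣ) (F : FormTuple n d K) (i : Fin n) (m : Fin n →₀ ℕ) :
    coeff m (conj (diagGL n K u) F i : MvPolynomial (Fin n) K) =
      (u i : K)⁻¹ * (∏ j, (u j : K) ^ m j) * coeff m (F i : MvPolynomial (Fin n) K) := by
  rw [coe_conj, Finset.sum_eq_single i, ← map_inv, coe_diagGL]
  · simp [coeff_subst_diagGL, mul_assoc]
  · intro j _ hj
    rw [← map_inv, coe_diagGL, Matrix.diagonal_apply_ne _ hj.symm, zero_smul]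
  · simp

/-- A diagonal matrix commutes with `F` exactly if every monomial that occurs in `F i`
has the same weight as the coordinate `i`. -/
lemma conj_diagGL_eq_self_iff (u : Fin n → Kˣ) (F : FormTuple n d K) :
    conj (diagGL n K u) F = F ↔
      ∀ i m, coeff m (F i : MvPolynomial (Fin n) K) ≠ 0 → ∏ j, u j ^ m j = u i := by
  constructor
  · intro h i m hm
    have := coeff_conj_diagGL u F i m
    rw [h, eq_comm, mul_eq_right₀ hm, inv_mul_eq_one₀ (u i).ne_zero] at this
    exact Units.ext (by simpa using this.symm)
  · intro h
    funext i
    refine Subtype.ext (MvPolynomial.ext _ _ fun m => ?_)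
    rw [coeff_conj_diagGL]
    by_cases hm : coeff m (F i : MvPolynomial (Fin n) K) = 0
    · simp [hm]
    · have := congrArg Units.val (h i m hm)
      rw [Units.coe_prod] at this
      simp only [Units.val_pow_eq_pow_val] at this
      rw [this, inv_mul_cancel₀ (u i).ne_zero, one_mul]

lemma conj_scalar (c : Kˣ) (F : FormTuple n 2 K) :
    conj (Matrix.GeneralLinearGroup.scalar (Fin n) c) F = (c : K) • F := by
  funext i
  refine Subtype.ext (MvPolynomial.ext _ _ fun m => ?_)
  rw [← diagGL_const, coeff_conj_diagGL]
  by_cases hm : coeff m (F i : MvPolynomial (Fin n) K) = 0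
  · simp [hm]
  · have hd : m.degree = 2 := by
      have := (F i).2
      rw [mem_homogeneousSubmodule] at this
      rw [Finsupp.degree_eq_weight_one]
      exact this hm
    rw [Finset.prod_pow_eq_pow_sum, ← Finsupp.degree_eq_sum, hd]
    simp [pow_two]

end Diagonal

/-! ### Lifting automorphisms to matrices that fix the tuple of forms -/

section Lift

variable {K : Type*} [Field K] {n : ℕ}

/-- The matrices that commute with the quadratic map `F` on the nose, not only up to a scalar. -/
def fixer (F : FormTuple n 2 K) : Subgroup (GL (Fin n) K) where
  carrier := {A | conj A F = F}
  mul_mem' := fun {A B} hA hB => by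
    simp only [Set.mem_ofPred_eq] at hA hB ⊢
    rw [conj_mul, hA, hB]
  one_mem' := conj_one F
  inv_mem' := fun {A} hA => by
    simp only [Set.mem_ofPred_eq] at hA ⊢
    conv_lhs => rw [← hA]
    rw [← conj_mul, mul_inv_cancel, conj_one]

lemma mem_fixer {F : FormTuple n 2 K} {A : GL (Fin n) K} : A ∈ fixer F ↔ conj A F = F := Iff.rfl

lemma mk_injOn_fixer {F : FormTuple n 2 K} (hF : F ≠ 0) {A B : GL (Fin n) K}
    (hA : A ∈ fixer F) (hB : B ∈ fixer F)
    (h : Matrix.ProjGenLinGroup.mk A = Matrix.ProjGenLinGroup.mk B) : A = B := by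
  obtain ⟨c, rfl⟩ := Matrix.ProjGenLinGroup.mk_eq_mk_iff.1 h
  rw [mem_fixer] at hA hB
  rw [conj_mul, hA, conj_scalar] at hB
  have : (c : K) = 1 := by
    by_contra hc
    refine hF ((smul_eq_zero.1 (?_ : ((c : K) - 1) • F = 0)).resolve_left (sub_ne_zero.2 hc))
    exact (sub_smul (c : K) 1 F).trans (by rw [hB, one_smul, sub_self])
  rw [Units.val_eq_one.1 this, map_one, mul_one]

/-- In degree `2` conjugation by a scalar matrix `c` multiplies a tuple by `c`, so the scalar
ambiguity in a lift of an automorphism is used up by asking that it fixes the tuple itself. -/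
lemma exists_mem_fixer {f : RatSpace n 2 K} {φ : PGL(n, K)} (hφ : φ ∈ Aut f) :
    ∃ A ∈ fixer f.rep, Matrix.ProjGenLinGroup.mk A = φ := by
  obtain ⟨A, hA, rfl⟩ := hφ
  change conjRat A f = f at hA
  rw [← f.mk_rep, conjRat, Projectivization.map_mk, Projectivization.mk_eq_mk_iff] at hA
  obtain ⟨c, hc⟩ := hA
  refine ⟨A * Matrix.GeneralLinearGroup.scalar (Fin n) c⁻¹, ?_, by simp⟩
  rw [mem_fixer, conj_mul, ← hc, conj_scalar]
  exact inv_smul_smul c f.rep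

lemma mk_mem_Aut {f : RatSpace n 2 K} {A : GL (Fin n) K} (hA : A ∈ fixer f.rep) :
    Matrix.ProjGenLinGroup.mk A ∈ Aut f := by
  refine ⟨A, ?_, rfl⟩
  change conjRat A f = f
  conv_lhs => rw [← f.mk_rep]
  rw [conjRat, Projectivization.map_mk]
  simp only [mem_fixer.1 hA, Projectivization.mk_rep]

/-- The lift of `Aut f` to the matrices that fix the chosen lift of `f`. -/
def liftAut (f : RatSpace n 2 K) : Aut f ≃* fixer f.rep :=
  (MulEquiv.ofBijective
    ((Matrix.ProjGenLinGroup.mk.comp (fixer f.rep).subtype).codRestrict (Aut f)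
      fun A => mk_mem_Aut A.2)
    ⟨fun A B h => Subtype.ext (mk_injOn_fixer f.rep_nonzero A.2 B.2 (congrArg Subtype.val h)),
      fun φ => by
        obtain ⟨A, hA, h⟩ := exists_mem_fixer φ.2
        exact ⟨⟨A, hA⟩, Subtype.ext h⟩⟩).symm

lemma mk_liftAut (f : RatSpace n 2 K) (φ : Aut f) :
    Matrix.ProjGenLinGroup.mk (liftAut f φ : GL (Fin n) K) = φ :=
  congrArg Subtype.val ((liftAut f).symm_apply_apply φ)

end Lift

/-! ### Simultaneous diagonalization -/

section Simultaneous

variable {K : Type*} [Field K] [CharZero K] {n : ℕ}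

open Module in
lemma isSemisimple_of_pow_eq_one {V : Type*} [AddCommGroup V] [Module K V]
    {a : End K V} {N : ℕ} (hN : N ≠ 0) (h : a ^ N = 1) : a.IsSemisimple := by
  refine Module.End.isSemisimple_of_squarefree_aeval_eq_zero (p := Polynomial.X ^ N - 1) ?_ (by simp [h])
  exact (Polynomial.separable_X_pow_sub_C (1 : K) (by exact_mod_cast hN) one_ne_zero).squarefree

variable [IsAlgClosed K]

open Module in
lemma exists_basis_joint_eigenvectors {ι : Type*} (a : ι → End K (Fin n → K)) {N : ℕ} (hN : N ≠ 0)
    (hpow : ∀ i, a i ^ N = 1) (hcomm : ∀ i j, Commute (a i) (a j)) :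
    ∃ (b : Basis (Fin n) K (Fin n → K)) (χ : ι → Fin n → K), ∀ i k, a i (b k) = χ i k • b k := by
  have htop := End.iSup_iInf_maxGenEigenspace_eq_top_of_iSup_maxGenEigenspace_eq_top_of_commute a
    (fun i j _ => hcomm i j) fun i => End.iSup_maxGenEigenspace_eq_top (a i)
  have hss := fun i μ => (isSemisimple_of_pow_eq_one hN
    (hpow i)).isFinitelySemisimple.maxGenEigenspace_eq_eigenspace μ
  simp only [hss] at htop
  set s : Set (Fin n → K) := {v | ∃ χ : ι → K, ∀ i, a i v = χ i • v}
  have hs : ⊤ ≤ Submodule.span K s := by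
    rw [← htop, iSup_le_iff]
    intro χ v hv
    refine Submodule.subset_span ⟨χ, fun i => ?_⟩
    exact End.mem_eigenspace_iff.1 ((Submodule.mem_iInf _).1 hv i)
  let b := Basis.ofSpan hs
  have := FiniteDimensional.fintypeBasisIndex b
  have hcard := (finrank_eq_card_basis b).symm
  rw [finrank_fin_fun] at hcard
  let b' := b.reindex (Fintype.equivFinOfCardEq hcard)
  have hb' : ∀ k, b' k ∈ s := fun k => by
    rw [Basis.reindex_apply]
    exact Basis.ofSpan_subset hs ⟨_, rfl⟩
  choose χ hχ using hb'
  exact ⟨b', fun i k => χ k i, fun i k => hχ k i⟩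

/-- Commuting matrices of finite order are simultaneously diagonalizable in characteristic `0`. -/
lemma exists_conj_eq_diagGL {ι : Type*} (A : ι → GL (Fin n) K) {N : ℕ} (hN : N ≠ 0)
    (hpow : ∀ i, A i ^ N = 1) (hcomm : ∀ i j, A i * A j = A j * A i) :
    ∃ (P : GL (Fin n) K) (χ : ι → Fin n → Kˣ), ∀ i, P⁻¹ * A i * P = diagGL n K (χ i) := by
  obtain ⟨b, χ, h⟩ := exists_basis_joint_eigenvectors
    (fun i => Matrix.toLinAlgEquiv' (A i : Matrix (Fin n) (Fin n) K)) hN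
    (fun i => by rw [← map_pow, ← Units.val_pow_eq_pow_val, hpow]; simp)
    (fun i j => by
      rw [Commute, SemiconjBy, ← map_mul, ← map_mul, ← Units.val_mul, hcomm, Units.val_mul])
  simp only [Matrix.toLinAlgEquiv'_apply] at h
  have hχ : ∀ i k, χ i k ≠ 0 := fun i k h0 => by
    have h1 := h i k
    rw [h0, zero_smul] at h1
    refine b.ne_zero k ?_
    have := congrArg (((A i)⁻¹ : GL (Fin n) K) : Matrix (Fin n) (Fin n) K).mulVec h1
    simpa [Matrix.mulVec_mulVec] using this
  let P : GL (Fin n) K :=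
    ⟨(Pi.basisFun K (Fin n)).toMatrix b, b.toMatrix (Pi.basisFun K (Fin n)),
      Module.Basis.toMatrix_mul_toMatrix_flip _ _, Module.Basis.toMatrix_mul_toMatrix_flip _ _⟩
  refine ⟨P, fun i k => Units.mk0 _ (hχ i k), fun i => ?_⟩
  rw [mul_assoc, inv_mul_eq_iff_eq_mul]
  ext r k
  have := congrFun (h i k) r
  rw [Units.val_mul, Units.val_mul, coe_diagGL, Matrix.mul_diagonal]
  simpa [P, Matrix.mul_apply, Matrix.mulVec, dotProduct, Module.Basis.toMatrix_apply,
    mul_comm] using this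

end Simultaneous

/-! ### Rigid systems of relations between three characters -/

section Weights

/-- The combinatorial shadow of a non-degenerate quadratic map with few symmetries. Here `T i j k`
says that the monomial `X j * X k` is allowed in the `i`-th form. Nontrivial integral weights for
which all allowed monomials are invariant would give a one-parameter group of automorphisms; an
`i`-th form without monomials, or two forms that are multiples of the same square, would give a
linear relation between the forms. -/
structure IsRigid (T : Fin 3 → Fin 3 → Fin 3 → Prop) : Prop where
  eq_zero_of_weight : ∀ w : Fin 3 → ℤ, (∀ i j k, T i j k → w j + w k = w i) → w = 0
  exists_monomial : ∀ i, ∃ j k, T i j k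
  exists_ne_sq : ∀ i i', i ≠ i' → ∀ j, ∃ k l, (T i k l ∨ T i' k l) ∧ ¬ (k = j ∧ l = j)

lemma IsRigid.perm {T : Fin 3 → Fin 3 → Fin 3 → Prop} (h : IsRigid T) (σ : Equiv.Perm (Fin 3)) :
    IsRigid fun i j k => T (σ i) (σ j) (σ k) where
  eq_zero_of_weight w hw := by
    have := h.eq_zero_of_weight (w ∘ σ.symm) fun i j k hT => hw _ _ _ (by simpa using hT)
    funext i
    simpa using congrFun this (σ i)
  exists_monomial i := by
    obtain ⟨j, k, h⟩ := h.exists_monomial (σ i)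
    exact ⟨σ.symm j, σ.symm k, by simpa using h⟩
  exists_ne_sq i i' hi j := by
    obtain ⟨k, l, h⟩ := h.exists_ne_sq (σ i) (σ i') (σ.injective.ne hi) (σ j)
    exact ⟨σ.symm k, σ.symm l, by simpa [Equiv.symm_apply_eq] using h⟩

lemma exists_perm_apply (i j : Fin 3) (h : i ≠ j) : ∃ σ : Equiv.Perm (Fin 3), σ 0 = i ∧ σ 1 = j := by
  decide +revert

lemma eq_or_eq_or_eq {i j k : Fin 3} (hij : i ≠ j) (hjk : j ≠ k) (hik : i ≠ k) (r : Fin 3) :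
    r = i ∨ r = j ∨ r = k := by
  decide +revert

lemma exists_perm_apply_zero (i : Fin 3) : ∃ σ : Equiv.Perm (Fin 3), σ 0 = i := by
  decide +revert

variable {R : Type*} [AddCommGroup R]

/-- Two equal characters are impossible, unless the third one differs from them by `2`-torsion. -/
lemma IsRigid.not_zero_eq_one {e : Fin 3 → R} (h : IsRigid fun i j k => e j + e k = e i)
    (h01 : e 0 = e 1) (h2 : e 0 + e 0 ≠ e 2 + e 2) : False := by
  obtain ⟨a, ha⟩ : ∃ a, e 0 = a := ⟨_, rfl⟩
  obtain ⟨b, hb⟩ : ∃ b, e 2 = b := ⟨_, rfl⟩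
  have ha' : e 1 = a := h01 ▸ ha
  rw [ha, hb] at h2
  have hab : a ≠ b := fun h => h2 (by rw [h])
  by_cases ha0 : a = 0
  · -- The third form is `X 2` times a linear form, and `X 2` does not occur in the other two.
    subst ha0
    rw [add_zero] at h2
    have := h.eq_zero_of_weight ![0, 0, 1] (by
      simp only [Fin.forall_fin_succ, Fin.succ_zero_eq_one, Fin.succ_one_eq_two, IsEmpty.forall_iff]
      simp [ha, ha', hb, hab.symm, h2.symm, hab])
    simpa using congrFun this 2
  by_cases hb0 : b = 0
  · -- The first two forms are `X 2` times linear forms, and the third is a multiple of `X 2 ^ 2`.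
    subst hb0
    rw [add_zero] at h2
    have := h.eq_zero_of_weight ![1, 1, 0] (by
      simp only [Fin.forall_fin_succ, Fin.succ_zero_eq_one, Fin.succ_one_eq_two, IsEmpty.forall_iff]
      simp [ha, ha', hb, hab.symm, h2, hab])
    simpa using congrFun this 0
  -- Otherwise the first two forms can only contain the square of the last variable.
  obtain ⟨k, l, hkl, hne⟩ := h.exists_ne_sq 0 1 (by decide) 2
  fin_cases k <;> fin_cases l <;> simp_all

section Prime

variable {p : ℕ} [Fact p.Prime]

lemma prime_eq_of_mul_eq_zero {q : ℕ} (hq : q.Prime) {x : ZMod p} (hx : x ≠ 0) (h : (q : ZMod p) * x = 0) :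
    p = q := by
  have h0 : (q : ZMod p) = 0 := (mul_eq_zero.1 h).resolve_right hx
  exact (Nat.prime_dvd_prime_iff_eq Fact.out hq).1 ((ZMod.natCast_eq_zero_iff q p).1 h0)

/-- If one of three distinct characters is trivial, then there is at most one relation besides the
trivial ones, and a torus survives, except for `p = 3`. -/
lemma IsRigid.eq_three {e : Fin 3 → ZMod p} (h : IsRigid fun i j k => e j + e k = e i)
    (he : Function.Injective e) (h0 : e 0 = 0) (hp : p ≠ 2) : p = 3 := by
  by_contra hp3
  obtain ⟨b, hb⟩ : ∃ b, e 1 = b := ⟨_, rfl⟩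
  obtain ⟨c, hc⟩ : ∃ c, e 2 = c := ⟨_, rfl⟩
  have hb0 : b ≠ 0 := by rw [← hb, ← h0]; exact he.ne (by decide)
  have hc0 : c ≠ 0 := by rw [← hc, ← h0]; exact he.ne (by decide)
  have hbc : b ≠ c := by rw [← hb, ← hc]; exact he.ne (by decide)
  have h3 : ∀ x : ZMod p, x ≠ 0 → 3 * x ≠ 0 := fun x hx h => hp3
    (prime_eq_of_mul_eq_zero Nat.prime_three hx (by exact_mod_cast h))
  have h2 : ∀ x : ZMod p, x ≠ 0 → 2 * x ≠ 0 := fun x hx h => hp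
    (prime_eq_of_mul_eq_zero Nat.prime_two hx (by exact_mod_cast h))
  have h3b := h3 b hb0
  have h3c := h3 c hc0
  have h2b := h2 b hb0
  have h2c := h2 c hc0
  by_cases h1 : b + b = c
  · have := h.eq_zero_of_weight ![0, 1, 2] (by
      intro i j k
      fin_cases i <;> fin_cases j <;> fin_cases k <;> simp [h0, hb, hc] <;> grind)
    simpa using congrFun this 1
  by_cases h1' : c + c = b
  · have := h.eq_zero_of_weight ![0, 2, 1] (by
      intro i j k
      fin_cases i <;> fin_cases j <;> fin_cases k <;> simp [h0, hb, hc] <;> grind)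
    simpa using congrFun this 1
  have := h.eq_zero_of_weight ![0, 1, -1] (by
      intro i j k
      fin_cases i <;> fin_cases j <;> fin_cases k <;> simp [h0, hb, hc] <;> grind)
  simpa using congrFun this 1

/-- If no character is trivial, each form needs a monomial without its own variable. Either
doubling permutes the three characters cyclically, and `p = 7`, or one character is the sum of the
other two and doubling links them in a chain, and `p = 5`. -/
lemma IsRigid.eq_five_or_seven {e : Fin 3 → ZMod p} (h : IsRigid fun i j k => e j + e k = e i)
    (he : Function.Injective e) (h0 : ∀ i, e i ≠ 0) (hp : p ≠ 2) :
    (p = 5 ∨ p = 7) ∧ ∃ σ : Equiv.Perm (Fin 3),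
      e (σ 1) = 2 * e (σ 0) ∧ e (σ 2) = 4 * e (σ 0) := by
  have key : ∀ i j k : Fin 3, i ≠ j → j ≠ k → i ≠ k →
      e j + e j = e i ∨ e k + e k = e i ∨ e j + e k = e i := by
    intro i j k hij hjk hik
    obtain ⟨r, s, hrs⟩ := h.exists_monomial i
    have := h0 r
    have := h0 s
    rcases eq_or_eq_or_eq hij hjk hik r with rfl | rfl | rfl <;>
      rcases eq_or_eq_or_eq hij hjk hik s with rfl | rfl | rfl <;> grind
  have conclude : ∀ σ : Equiv.Perm (Fin 3), e (σ 1) = 2 * e (σ 0) → e (σ 2) = 4 * e (σ 0) →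
      (5 * e (σ 0) = 0 ∨ 7 * e (σ 0) = 0) → (p = 5 ∨ p = 7) ∧ ∃ σ : Equiv.Perm (Fin 3),
      e (σ 1) = 2 * e (σ 0) ∧ e (σ 2) = 4 * e (σ 0) := by
    intro σ h1 h2 h3
    refine ⟨h3.imp (fun h => ?_) fun h => ?_, σ, h1, h2⟩
    · exact prime_eq_of_mul_eq_zero Nat.prime_five (h0 _) (by exact_mod_cast h)
    · exact prime_eq_of_mul_eq_zero (by norm_num) (h0 _) (by exact_mod_cast h)
  have h2 : ∀ x : ZMod p, 2 * x = 0 → x = 0 := fun x h => by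
    by_contra hx
    exact hp (prime_eq_of_mul_eq_zero Nat.prime_two hx (by exact_mod_cast h))
  -- A chain `i, j, k` along which the characters double. The remaining relation, for `e i`, is
  -- `e k + e k = e i` or `e j + e k = e i`, which gives `7 * e i = 0` or `5 * e i = 0`. All other
  -- choices of one relation per form give equal or trivial characters.
  have main : ∃ i j k : Fin 3, i ≠ j ∧ j ≠ k ∧ i ≠ k ∧ e i + e i = e j ∧ e j + e j = e k ∧
      (5 * e i = 0 ∨ 7 * e i = 0) := by
    have n01 := he.ne (show (0 : Fin 3) ≠ 1 by decide)
    have n02 := he.ne (show (0 : Fin 3) ≠ 2 by decide)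
    have n12 := he.ne (show (1 : Fin 3) ≠ 2 by decide)
    have z0 := h0 0
    have z1 := h0 1
    have z2 := h0 2
    have t0 := h2 (e 0)
    have t1 := h2 (e 1)
    have t2 := h2 (e 2)
    rcases key 0 1 2 (by decide) (by decide) (by decide) with h | h | h <;>
    rcases key 1 0 2 (by decide) (by decide) (by decide) with h' | h' | h' <;>
    rcases key 2 0 1 (by decide) (by decide) (by decide) with h'' | h'' | h'' <;>
    first
    | exfalso; grind
    | exact ⟨0, 1, 2, by decide, by decide, by decide, by grind, by grind, by grind⟩
    | exact ⟨0, 2, 1, by decide, by decide, by decide, by grind, by grind, by grind⟩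
    | exact ⟨1, 0, 2, by decide, by decide, by decide, by grind, by grind, by grind⟩
    | exact ⟨1, 2, 0, by decide, by decide, by decide, by grind, by grind, by grind⟩
    | exact ⟨2, 0, 1, by decide, by decide, by decide, by grind, by grind, by grind⟩
    | exact ⟨2, 1, 0, by decide, by decide, by decide, by grind, by grind, by grind⟩
  obtain ⟨i, j, k, hij, hjk, hik, hj, hk, hi⟩ := main
  obtain ⟨σ, rfl, rfl⟩ := exists_perm_apply i j hij
  obtain rfl : k = σ 2 := by
    rcases eq_or_eq_or_eq (i := σ 0) (j := σ 1) (k := σ 2) (by simp) (by simp) (by simp) k with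
      h | h | h
    · exact absurd h.symm hik
    · exact absurd h.symm hjk
    · exact h
  exact conclude σ (by rw [← hj]; ring) (by rw [← hk, ← hj]; ring) hi

end Prime

end Weights

/-! ### Relations between the eigenvalues of an automorphism -/

section Rigid

variable {K : Type*} [Field K]

lemma exists_eq_single_add_single {m : Fin 3 →₀ ℕ} (hm : m.degree = 2) :
    ∃ j k, m = Finsupp.single j 1 + Finsupp.single k 1 := by
  have step : ∀ {l : Fin 3 →₀ ℕ} {r : ℕ}, l.degree = r + 1 →
      ∃ j l', l = Finsupp.single j 1 + l' ∧ l'.degree = r := by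
    intro l r hl
    obtain ⟨j, hj⟩ : ∃ j, l j ≠ 0 := by
      by_contra! h
      rw [show l = 0 from Finsupp.ext h] at hl
      simp at hl
    have h1 : Finsupp.single j 1 ≤ l := by
      rw [Finsupp.single_le_iff]; lia
    obtain ⟨l', rfl⟩ := le_iff_exists_add.1 h1
    rw [map_add, Finsupp.degree_single] at hl
    exact ⟨j, l', rfl, by lia⟩
  obtain ⟨j, m', rfl, h'⟩ := step hm
  obtain ⟨k, m'', rfl, h''⟩ := step h'
  rw [Finsupp.degree_eq_zero_iff] at h''
  exact ⟨j, k, by rw [h'', add_zero]⟩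

lemma prod_pow_single_add_single {M : Type*} [CommMonoid M] (u : Fin 3 → M) (j k : Fin 3) :
    ∏ i, u i ^ (Finsupp.single j 1 + Finsupp.single k 1 : Fin 3 →₀ ℕ) i = u j * u k := by
  simp only [Finsupp.add_apply, pow_add, Finset.prod_mul_distrib]
  simp [Finsupp.single_apply, pow_ite]

lemma exists_of_coeff_ne_zero {F : FormTuple 3 2 K} {i : Fin 3} {m : Fin 3 →₀ ℕ}
    (h : coeff m (F i : MvPolynomial (Fin 3) K) ≠ 0) :
    ∃ j k, m = Finsupp.single j 1 + Finsupp.single k 1 := by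
  refine exists_eq_single_add_single ?_
  have := (F i).2
  rw [mem_homogeneousSubmodule] at this
  rw [Finsupp.degree_eq_weight_one]
  exact this h

variable [CharZero K]

/-- The relations between the eigenvalues of a diagonal matrix commuting with `F` are rigid if the
forms are linearly independent and only finitely many matrices commute with `F`. -/
lemma isRigid_of_conj_eq {F : FormTuple 3 2 K} {u : Fin 3 → Kˣ} (hu : conj (diagGL 3 K u) F = F)
    (hlin : ∀ a : Fin 3 → K, ∑ i, a i • (F i : MvPolynomial (Fin 3) K) = 0 → a = 0)
    (hfin : Finite (fixer F)) : IsRigid fun i j k => u j * u k = u i := by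
  have hT : ∀ {i m}, coeff m (F i : MvPolynomial (Fin 3) K) ≠ 0 →
      ∃ j k, m = Finsupp.single j 1 + Finsupp.single k 1 ∧ u j * u k = u i := by
    intro i m hm
    obtain ⟨j, k, rfl⟩ := exists_of_coeff_ne_zero hm
    refine ⟨j, k, rfl, ?_⟩
    rw [← prod_pow_single_add_single]
    exact (conj_diagGL_eq_self_iff u F).1 hu i _ hm
  have hne : ∀ i, (F i : MvPolynomial (Fin 3) K) ≠ 0 := fun i h0 => by
    have := congrFun (hlin (Pi.single i 1) (by simp [Pi.single_apply, h0])) i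
    simp at this
  refine ⟨fun w hw => ?_, fun i => ?_, fun i i' hi j => ?_⟩
  · -- The element `2 ^ w` of the torus would have infinite order.
    let v : Fin 3 → Kˣ := fun i => Units.mk0 2 two_ne_zero ^ w i
    have hv : diagGL 3 K v ∈ fixer F := by
      refine (conj_diagGL_eq_self_iff v F).2 fun i m hm => ?_
      obtain ⟨j, k, rfl, h⟩ := hT hm
      rw [prod_pow_single_add_single]
      simp only [v, ← hw i j k h, zpow_add]
    obtain ⟨N, hN, hpow⟩ := isOfFinOrder_iff_pow_eq_one.1 (isOfFinOrder_of_finite (⟨_, hv⟩ : fixer F))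
    have hpow' : diagGL 3 K (v ^ N) = diagGL 3 K 1 := by
      rw [map_pow, map_one]
      exact congrArg Subtype.val hpow
    funext i
    have h1 := congrArg Units.val (congrFun (diagGL_injective hpow') i)
    -- The order on `ℚ` shows that the exponent vanishes.
    have h2 : (2 : ℚ) ^ (w i * N) = 1 := by
      have h3 : ((2 : K) ^ (w i * N)) = 1 := by
        rw [zpow_mul, zpow_natCast]
        simpa [v] using h1
      have h5 : (((2 : ℚ) ^ (w i * N) : ℚ) : K) = ((1 : ℚ) : K) := by
        push_cast
        exact h3
      exact Rat.cast_injective h5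
    have h4 := (zpow_eq_one_iff_right₀ (by norm_num) (by norm_num)).1 h2
    simpa [hN.ne'] using h4
  · obtain ⟨m, hm⟩ := MvPolynomial.ne_zero_iff.1 (hne i)
    obtain ⟨j, k, -, h⟩ := hT hm
    exact ⟨j, k, h⟩
  · by_contra! hcon
    have hz : ∀ m, m ≠ Finsupp.single j 1 + Finsupp.single j 1 →
        coeff m (F i : MvPolynomial (Fin 3) K) = 0 ∧ coeff m (F i' : MvPolynomial (Fin 3) K) = 0 := by
      intro m hm
      constructor <;> by_contra h0 <;> obtain ⟨k, l, rfl, h⟩ := hT h0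
      · obtain ⟨rfl, rfl⟩ := hcon k l (Or.inl h)
        exact hm rfl
      · obtain ⟨rfl, rfl⟩ := hcon k l (Or.inr h)
        exact hm rfl
    -- Both forms are multiples of `X j ^ 2`, which makes them linearly dependent.
    set m₀ : Fin 3 →₀ ℕ := Finsupp.single j 1 + Finsupp.single j 1
    have := hlin (Pi.single i (coeff m₀ (F i' : MvPolynomial (Fin 3) K)) -
      Pi.single i' (coeff m₀ (F i : MvPolynomial (Fin 3) K))) (by
        ext m
        simp only [Pi.sub_apply, sub_smul, Finset.sum_sub_distrib, Pi.single_apply, ite_smul, zero_smul,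
          Finset.sum_ite_eq', Finset.mem_univ, if_true, coeff_sub, coeff_smul, coeff_zero, smul_eq_mul]
        by_cases hm : m = m₀
        · rw [hm]; ring
        · simp [hz m hm])
    have h0 : coeff m₀ (F i' : MvPolynomial (Fin 3) K) = 0 := by
      simpa [hi] using congrFun this i
    refine hne i' (MvPolynomial.ext _ _ fun m => ?_)
    by_cases hm : m = m₀
    · rw [hm, h0, coeff_zero]
    · rw [(hz m hm).2, coeff_zero]

end Rigid

/-! ### Diagonalizing commutative groups of automorphisms -/

section DiagonalizeAut

variable {K : Type*} [Field K] {n : ℕ}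

/-- The forms of a dominant map are linearly independent: test dominance on linear forms. -/
lemma IsDominant.eq_zero_of_sum_smul {d : ℕ} {f : RatSpace n d K} (hf : IsDominant f)
    {a : Fin n → K} (h : ∑ i, a i • (f.rep i : MvPolynomial (Fin n) K) = 0) : a = 0 := by
  have hP := hf 1 (∑ i, C (a i) * X i)
    (IsHomogeneous.sum _ _ _ fun i _ => isHomogeneous_C_mul_X _ _) fun x _ => by
      simpa [value, smul_eval] using congrArg (eval x) h
  funext i
  simpa [coeff_sum, coeff_C_mul, coeff_X, Finsupp.single_left_inj] using
    congrArg (coeff (Finsupp.single i 1)) hP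

lemma subst_injective (A : GL (Fin n) K) : Function.Injective (subst A) := fun p q h => by
  have := congrArg (subst A⁻¹) h
  simpa [← subst_mul, subst_one] using this

lemma eq_zero_of_sum_smul_conj {d : ℕ} {F : FormTuple n d K}
    (hF : ∀ a : Fin n → K, ∑ i, a i • (F i : MvPolynomial (Fin n) K) = 0 → a = 0)
    (P : GL (Fin n) K) {a : Fin n → K}
    (h : ∑ i, a i • (conj P F i : MvPolynomial (Fin n) K) = 0) : a = 0 := by
  have h1 : Matrix.vecMul a ((P⁻¹ : GL (Fin n) K) : Matrix (Fin n) (Fin n) K) = 0 := by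
    refine hF _ (subst_injective P ?_)
    rw [map_zero, ← h]
    simp only [coe_conj, Matrix.vecMul, dotProduct, Finset.sum_smul, Finset.smul_sum, map_sum,
      map_smul, smul_smul]
    rw [Finset.sum_comm]
  have h2 := congrArg (fun v => Matrix.vecMul v (P : Matrix (Fin n) (Fin n) K)) h1
  simpa [Matrix.vecMul_vecMul] using h2

lemma conj_mem_fixer {F : FormTuple n 2 K} {A : GL (Fin n) K} (hA : A ∈ fixer F) (P : GL (Fin n) K) :
    P⁻¹ * A * P ∈ fixer (conj P F) := by
  rw [mem_fixer, ← conj_mul, mul_assoc, mul_inv_cancel_left, conj_mul, mem_fixer.1 hA]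

lemma finite_fixer_conj {F : FormTuple n 2 K} [Finite (fixer F)] (P : GL (Fin n) K) :
    Finite (fixer (conj P F)) := by
  have h : ∀ A : fixer (conj P F), P * A * P⁻¹ ∈ fixer F := fun A => by
    simpa [← conj_mul, conj_one] using conj_mem_fixer A.2 P⁻¹
  exact Finite.of_injective (fun A => (⟨_, h A⟩ : fixer F)) fun A B hAB =>
    Subtype.ext (mul_left_cancel (mul_right_cancel (congrArg Subtype.val hAB)))

/-- A finite commutative group of automorphisms can be diagonalized by one coordinate change, with
eigenvalues (of the lifts that fix the quadratic map itself) whose relations are rigid. -/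
lemma exists_diagonalization [IsAlgClosed K] [CharZero K] {f : RatSpace 3 2 K} (hdom : IsDominant f)
    (hfin : Finite (Aut f)) {H : Subgroup PGL(3, K)} (hH : H ≤ Aut f) {N : ℕ} (hN : N ≠ 0)
    (hpow : ∀ h ∈ H, h ^ N = 1) (hcomm : ∀ g ∈ H, ∀ h ∈ H, g * h = h * g) :
    ∃ φ : PGL(3, K), ∀ h ∈ H, ∃ u : Fin 3 → Kˣ, φ * h * φ⁻¹ = Matrix.ProjGenLinGroup.mk (diagGL 3 K u) ∧
      u ^ N = 1 ∧ IsRigid fun i j k => u j * u k = u i := by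
  let ρ : H →* GL (Fin 3) K :=
    (fixer f.rep).subtype.comp ((liftAut f).toMonoidHom.comp (Subgroup.inclusion hH))
  have hρ : ∀ h, ρ h ∈ fixer f.rep := fun h => (liftAut f (Subgroup.inclusion hH h)).2
  have hmk : ∀ h, Matrix.ProjGenLinGroup.mk (ρ h) = h := fun h =>
    mk_liftAut f (Subgroup.inclusion hH h)
  obtain ⟨P, χ, hP⟩ := exists_conj_eq_diagGL ρ hN
    (fun h => by rw [← map_pow, show h ^ N = 1 from Subtype.ext (hpow h h.2), map_one])
    (fun g h => by
      rw [← map_mul, ← map_mul, show g * h = h * g from Subtype.ext (hcomm g g.2 h h.2)])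
  have : Finite (fixer f.rep) := Finite.of_equiv _ (liftAut f).toEquiv
  refine ⟨(Matrix.ProjGenLinGroup.mk P)⁻¹, fun h hh => ⟨χ ⟨h, hh⟩, ?_, ?_, ?_⟩⟩
  · rw [← hP, map_mul, map_mul, map_inv, hmk ⟨h, hh⟩, inv_inv]
  · refine diagGL_injective ?_
    have hc : (P⁻¹ * ρ ⟨h, hh⟩ * P) ^ N = P⁻¹ * ρ ⟨h, hh⟩ ^ N * P := by
      simpa only [inv_inv] using (_root_.conj_pow : (P⁻¹ * ρ ⟨h, hh⟩ * P⁻¹⁻¹) ^ N = _)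
    rw [map_pow, ← hP, hc, ← map_pow,
      show (⟨h, hh⟩ : H) ^ N = 1 from Subtype.ext (hpow h hh), map_one, map_one, mul_one,
      inv_mul_cancel]
  · refine isRigid_of_conj_eq (F := conj P f.rep) ?_
      (fun a => eq_zero_of_sum_smul_conj (fun a => hdom.eq_zero_of_sum_smul) P)
      (finite_fixer_conj P)
    rw [← hP]
    exact conj_mem_fixer (hρ _) P

end DiagonalizeAut

/-! ### Subgroups of the diagonal torus up to conjugation -/

section Torus

variable {K : Type*} [Field K]

lemma diag_eq_mk (a b c : Kˣ) : diag a b c = Matrix.ProjGenLinGroup.mk (diagGL 3 K ![a, b, c]) := by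
  refine congrArg (fun A : GL (Fin 3) K => Matrix.ProjGenLinGroup.mk A) (Units.ext ?_)
  rw [coe_diagGL]
  change Matrix.diagonal _ = _
  congr 1
  funext i
  fin_cases i <;> rfl

lemma mk_diagGL_eq_iff {n : ℕ} {u v : Fin n → Kˣ} :
    Matrix.ProjGenLinGroup.mk (diagGL n K u) = Matrix.ProjGenLinGroup.mk (diagGL n K v) ↔
      ∃ s : Kˣ, ∀ i, u i = s * v i := by
  rw [eq_comm, Matrix.ProjGenLinGroup.mk_eq_mk_iff]
  refine exists_congr fun s => ?_
  rw [← diagGL_const, ← map_mul, diagGL_injective.eq_iff, funext_iff]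
  exact forall_congr' fun i => by rw [eq_comm, Pi.mul_apply, mul_comm]

lemma exists_conj_diagGL_perm {n : ℕ} (σ : Equiv.Perm (Fin n)) :
    ∃ Q : GL (Fin n) K, ∀ u, Q * diagGL n K u * Q⁻¹ = diagGL n K (u ∘ σ) := by
  refine ⟨⟨σ.permMatrix K, σ⁻¹.permMatrix K, ?_, ?_⟩, fun u => ?_⟩
  · rw [← Matrix.permMatrix_mul]; simp
  · rw [← Matrix.permMatrix_mul]; simp
  · rw [mul_inv_eq_iff_eq_mul]
    ext i j
    rw [Units.val_mul, Units.val_mul, coe_diagGL, coe_diagGL, Matrix.mul_diagonal,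
      Matrix.diagonal_mul]
    simp only [Equiv.Perm.permMatrix, PEquiv.toMatrix_apply, Equiv.toPEquiv_apply,
      Option.mem_some_iff, Function.comp_apply]
    split_ifs with h
    · rw [h, mul_comm]
    · simp

/-- A group of order `n` is conjugate to the cyclic group generated by `diag 1 ζ z` as soon as
it contains a conjugate of the generator. -/
lemma isConjSubgroup_closure_diag {H : Subgroup PGL(3, K)} {n : ℕ} (hn : n ≠ 0)
    (hcard : Nat.card H = n) {ζ : Kˣ} (hζ : IsPrimitiveRoot ζ n) {z : Kˣ} {φ g : PGL(3, K)}
    (hg : g ∈ H) (h : φ * g * φ⁻¹ = diag 1 ζ z) :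
    IsConjSubgroup H (Subgroup.closure {diag 1 ζ z}) := by
  have hcard' : Nat.card (H.map (MulAut.conj φ).toMonoidHom) = n := by
    rw [← hcard]
    exact Subgroup.card_map_of_injective (MulAut.conj φ).injective
  have : Finite (H.map (MulAut.conj φ).toMonoidHom) := Nat.finite_of_card_ne_zero (by rwa [hcard'])
  have hmem : diag 1 ζ z ∈ H.map (MulAut.conj φ).toMonoidHom := ⟨g, hg, by simpa using h⟩
  have hord : n ∣ orderOf (diag 1 ζ z) := by
    rw [← hζ.pow_eq_one_iff_dvd]
    have h1 := pow_orderOf_eq_one (diag 1 ζ z)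
    rw [diag_eq_mk, ← map_pow, ← map_pow, ← map_one Matrix.ProjGenLinGroup.mk,
      ← map_one (diagGL 3 K), mk_diagGL_eq_iff] at h1
    obtain ⟨s, hs⟩ := h1
    have hs0 := hs 0
    have hs1 := hs 1
    simp only [Pi.pow_apply, Matrix.cons_val_zero, Matrix.cons_val_one, one_pow, Pi.one_apply,
      mul_one, ← diag_eq_mk] at hs0 hs1
    rw [hs1, ← hs0]
  have hpos : 0 < orderOf (diag 1 ζ z) :=
    orderOf_pos_iff.2 (Submonoid.isOfFinOrder_coe.2
      (isOfFinOrder_of_finite (⟨_, hmem⟩ : H.map (MulAut.conj φ).toMonoidHom)))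
  refine ⟨φ, (Subgroup.eq_of_le_of_card_ge ?_ ?_).symm⟩
  · rwa [Subgroup.closure_le, Set.singleton_subset_iff]
  · rw [hcard', ← Subgroup.zpowers_eq_closure, Nat.card_zpowers]
    exact Nat.le_of_dvd hpos hord

/-- The same, when the conjugate of the generator appears as the `k`-th power of a diagonal class,
up to the scalar `s` and the permutation `σ` of the coordinates. -/
lemma isConjSubgroup_of_pow_perm {H : Subgroup PGL(3, K)} {n : ℕ} (hn : n ≠ 0)
    (hcard : Nat.card H = n) {ζ : Kˣ} (hζ : IsPrimitiveRoot ζ n) {z : Kˣ} {φ g : PGL(3, K)}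
    (hg : g ∈ H) {u : Fin 3 → Kˣ} (h : φ * g * φ⁻¹ = Matrix.ProjGenLinGroup.mk (diagGL 3 K u))
    (σ : Equiv.Perm (Fin 3)) (k : ℕ) (s : Kˣ) (hu : ∀ i, u (σ i) ^ k = s * ![1, ζ, z] i) :
    IsConjSubgroup H (Subgroup.closure {diag 1 ζ z}) := by
  obtain ⟨Q, hQ⟩ := exists_conj_diagGL_perm (K := K) σ
  refine isConjSubgroup_closure_diag hn hcard hζ (φ := Matrix.ProjGenLinGroup.mk Q * φ)
    (H.pow_mem hg k) ?_
  rw [diag_eq_mk]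
  calc Matrix.ProjGenLinGroup.mk Q * φ * g ^ k * (Matrix.ProjGenLinGroup.mk Q * φ)⁻¹
      = Matrix.ProjGenLinGroup.mk Q * (φ * g * φ⁻¹) ^ k * (Matrix.ProjGenLinGroup.mk Q)⁻¹ := by
        rw [conj_pow]; group
    _ = Matrix.ProjGenLinGroup.mk (diagGL 3 K ((u ^ k) ∘ σ)) := by
        rw [h, ← map_pow, ← map_pow, ← map_inv, ← map_mul, ← map_mul, hQ]
    _ = _ := mk_diagGL_eq_iff.2 ⟨s, hu⟩

lemma units_eq_one_or_neg_one {x : Kˣ} (h : x ^ 2 = 1) : x = 1 ∨ x = -1 := by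
  have h1 := congrArg Units.val h
  rw [Units.val_pow_eq_pow_val, Units.val_one, sq_eq_one_iff] at h1
  exact h1.imp Units.ext fun h2 => Units.ext (by simpa using h2)

/-- All Klein four-groups of diagonal classes whose representatives are involutions coincide. -/
lemma isConjSubgroup_klein {H : Subgroup PGL(3, K)} (hcard : Nat.card H = 4) {φ : PGL(3, K)}
    (h : ∀ g ∈ H, ∃ u : Fin 3 → Kˣ, φ * g * φ⁻¹ = Matrix.ProjGenLinGroup.mk (diagGL 3 K u) ∧ u ^ 2 = 1) :
    IsConjSubgroup H (Subgroup.closure {diag 1 (-1) 1, diag 1 1 (-1)}) := by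
  have hcard' : Nat.card (H.map (MulAut.conj φ).toMonoidHom) = 4 := by
    rw [← hcard]
    exact Subgroup.card_map_of_injective (MulAut.conj φ).injective
  let s : Fin 2 → Kˣ := ![1, -1]
  have hsub : ((H.map (MulAut.conj φ).toMonoidHom : Subgroup PGL(3, K)) : Set PGL(3, K)) ⊆
      Set.range fun x : Fin 2 × Fin 2 => diag 1 (s x.1) (s x.2) := by
    rintro _ ⟨g, hg, rfl⟩
    obtain ⟨u, hu, hu2⟩ := h g hg
    have hs : ∀ i, ∃ x, s x = u i / u 0 := fun i => by
      have : (u i / u 0) ^ 2 = 1 := by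
        rw [div_pow, show u i ^ 2 = 1 from congrFun hu2 i, show u 0 ^ 2 = 1 from congrFun hu2 0,
          div_one]
      rcases units_eq_one_or_neg_one this with h | h
      · exact ⟨0, h.symm⟩
      · exact ⟨1, h.symm⟩
    obtain ⟨x, hx⟩ := hs 1
    obtain ⟨y, hy⟩ := hs 2
    refine ⟨(x, y), ?_⟩
    change diag 1 (s x) (s y) = φ * g * φ⁻¹
    rw [hu, hx, hy, diag_eq_mk, eq_comm, mk_diagGL_eq_iff]
    refine ⟨u 0, fun i => ?_⟩
    fin_cases i <;> simp
  have heq : ((H.map (MulAut.conj φ).toMonoidHom : Subgroup PGL(3, K)) : Set PGL(3, K)) =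
      Set.range fun x : Fin 2 × Fin 2 => diag 1 (s x.1) (s x.2) := by
    refine Set.eq_of_subset_of_ncard_le hsub ?_ (Set.finite_range _)
    rw [← Set.image_univ]
    refine (Set.ncard_image_le).trans ?_
    rw [Set.ncard_univ, ← Nat.card_coe_set_eq]
    exact (show Nat.card (Fin 2 × Fin 2) = 4 by simp).trans_le hcard'.ge
  refine ⟨φ, le_antisymm ?_ ?_⟩
  · intro x hx
    obtain ⟨⟨a, b⟩, rfl⟩ := hsub hx
    have h1 : diag 1 (-1) 1 ∈ Subgroup.closure {diag 1 (-1) 1, diag (K := K) 1 1 (-1)} :=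
      Subgroup.subset_closure (by simp)
    have h2 : diag 1 1 (-1) ∈ Subgroup.closure {diag 1 (-1) 1, diag (K := K) 1 1 (-1)} :=
      Subgroup.subset_closure (by simp)
    have h3 : diag (1 : Kˣ) (-1) 1 * diag 1 1 (-1) = diag 1 (-1) (-1) := by
      rw [diag_eq_mk, diag_eq_mk, diag_eq_mk, ← map_mul, ← map_mul]
      congr 2
      funext i
      fin_cases i <;> simp
    have h4 : diag (1 : Kˣ) 1 1 = 1 := by
      rw [diag_eq_mk, ← map_one Matrix.ProjGenLinGroup.mk, ← map_one (diagGL 3 K)]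
      congr 2
      funext i
      fin_cases i <;> simp
    fin_cases a <;> fin_cases b
    · change diag 1 1 1 ∈ _
      rw [h4]
      exact one_mem _
    · exact h2
    · exact h1
    · change diag 1 (-1) (-1) ∈ _
      rw [← h3]
      exact mul_mem h1 h2
  · rw [Subgroup.closure_le, heq]
    rintro x (rfl | rfl)
    · exact ⟨(1, 0), rfl⟩
    · exact ⟨(0, 1), rfl⟩

end Torus

/-! ### Subgroups of order four and of odd prime order -/

section Classification

/-- The characters of a rigid system are pairwise distinct, unless all of them differ only by
`2`-torsion. -/
lemma IsRigid.injective {R : Type*} [AddCommGroup R] {e : Fin 3 → R}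
    (h : IsRigid fun i j k => e j + e k = e i) (h2 : ¬ ∀ i j, e i + e i = e j + e j) :
    Function.Injective e := by
  intro i j hij
  by_contra hne
  obtain ⟨σ, rfl, rfl⟩ := exists_perm_apply i j hne
  refine (h.perm σ).not_zero_eq_one (e := e ∘ σ) hij fun h02 => h2 ?_
  have h' : ∀ i, e (σ i) + e (σ i) = e (σ 0) + e (σ 0) := fun i => by
    fin_cases i
    · rfl
    · exact (congrArg₂ (· + ·) hij hij).symm
    · exact h02.symm
  intro i j
  have hi := h' (σ.symm i)
  have hj := h' (σ.symm j)
  rw [Equiv.apply_symm_apply] at hi hj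
  rw [hi, hj]

variable {K : Type*} [Field K]

lemma pow_eq_pow_iff_natCast_zmod {M : Type*} [CommGroup M] {ζ : M} {n : ℕ}
    (hζ : IsPrimitiveRoot ζ n) {a b : ℕ} : ζ ^ a = ζ ^ b ↔ (a : ZMod n) = b := by
  rw [pow_eq_pow_iff_modEq, ← hζ.eq_orderOf, ZMod.natCast_eq_natCast_iff]

lemma exists_zmod_exponents {n : ℕ} [NeZero n] {ζ : Kˣ} (hζ : IsPrimitiveRoot ζ n)
    {u : Fin 3 → Kˣ} (hu : u ^ n = 1) : ∃ e : Fin 3 → ZMod n, ∀ i, u i = ζ ^ (e i).val := by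
  have : ∀ i, ∃ a : ZMod n, u i = ζ ^ a.val := fun i => by
    obtain ⟨k, -, hk⟩ := (IsPrimitiveRoot.coe_units_iff.2 hζ).eq_pow_of_pow_eq_one
      (show (u i : K) ^ n = 1 from congrArg Units.val (congrFun hu i))
    rw [← Units.val_pow_eq_pow_val, Units.val_inj] at hk
    exact ⟨k, by rw [← hk, pow_eq_pow_iff_natCast_zmod hζ]; simp⟩
  choose e he using this
  exact ⟨e, he⟩

/-- The exponents of a diagonal class `u` whose square is nontrivial are pairwise distinct. -/
lemma exponents_rigid_injective {n : ℕ} [NeZero n] {ζ : Kˣ} (hζ : IsPrimitiveRoot ζ n)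
    {u : Fin 3 → Kˣ} (hrig : IsRigid fun i j k => u j * u k = u i)
    (hne : Matrix.ProjGenLinGroup.mk (diagGL 3 K u) ^ 2 ≠ 1) {e : Fin 3 → ZMod n}
    (he : ∀ i, u i = ζ ^ (e i).val) :
    (IsRigid fun i j k => e j + e k = e i) ∧ Function.Injective e := by
  have hT : (fun i j k => u j * u k = u i) = fun i j k => e j + e k = e i := by
    funext i j k
    rw [he, he, he, ← pow_add, pow_eq_pow_iff_natCast_zmod hζ]
    simp
  rw [hT] at hrig
  refine ⟨hrig, hrig.injective fun h => hne ?_⟩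
  rw [← map_pow, ← map_pow, ← map_one Matrix.ProjGenLinGroup.mk, ← map_one (diagGL 3 K),
    mk_diagGL_eq_iff]
  refine ⟨u 0 ^ 2, fun i => ?_⟩
  rw [Pi.pow_apply, Pi.one_apply, mul_one, sq, sq, he, he, ← pow_add, ← pow_add,
    pow_eq_pow_iff_natCast_zmod hζ]
  simpa using h i 0

lemma exists_perm_zmod_three : ∀ e : Fin 3 → ZMod 3, Function.Injective e →
    ∃ σ : Equiv.Perm (Fin 3), ∀ i, e (σ i) = (i : ℕ) := by
  decide

/-- Three distinct elements of `ZMod 4` are consecutive up to order: only one residue is missing. -/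
lemma exists_perm_zmod_four : ∀ e : Fin 3 → ZMod 4, Function.Injective e →
    ∃ (σ : Equiv.Perm (Fin 3)) (m : ZMod 4), ∀ i, e (σ i) = m + (i : ℕ) := by
  decide

variable [IsAlgClosed K] [CharZero K]
  {ζ₃ ζ₄ ζ₅ ζ₇ : Kˣ} {f : RatSpace 3 2 K} {H : Subgroup PGL(3, K)}

lemma isConjToListed_of_card_eq_prime (h₃ : IsPrimitiveRoot ζ₃ 3)
    (h₅ : IsPrimitiveRoot ζ₅ 5) (h₇ : IsPrimitiveRoot ζ₇ 7) (hdom : IsDominant f)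
    (hfin : Finite (Aut f)) (hH : H ≤ Aut f) {p : ℕ} (hp : p.Prime) (hodd : Odd p)
    (hcard : Nat.card H = p) : IsConjToListed ζ₃ ζ₄ ζ₅ ζ₇ H := by
  have : Fact p.Prime := ⟨hp⟩
  have hp2 : p ≠ 2 := by rintro rfl; exact absurd hodd (by decide)
  have hcyc : IsCyclic H := isCyclic_of_prime_card hcard
  have hpow : ∀ h ∈ H, h ^ p = 1 := fun h hh => by
    have := pow_card_eq_one' (x := (⟨h, hh⟩ : H))
    rw [hcard] at this
    exact congrArg Subtype.val this
  obtain ⟨φ, hφ⟩ := exists_diagonalization hdom hfin hH hp.ne_zero hpow fun g hg h hh =>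
    congrArg Subtype.val (mul_comm' (⟨g, hg⟩ : H) ⟨h, hh⟩)
  have : Finite H := Nat.finite_of_card_ne_zero (hcard ▸ hp.ne_zero)
  have hnt : Nontrivial H := Finite.one_lt_card_iff_nontrivial.1 (hcard ▸ hp.one_lt)
  obtain ⟨⟨g, hg⟩, hg1'⟩ := exists_ne (1 : H)
  have hg1 : g ≠ 1 := fun h => hg1' (Subtype.ext h)
  obtain ⟨u, hu, hup, hrig⟩ := hφ g hg
  have hne : Matrix.ProjGenLinGroup.mk (diagGL 3 K u) ^ 2 ≠ 1 := by
    rw [← hu, conj_pow]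
    intro h2
    rw [conj_eq_one_iff] at h2
    have h1 := pow_gcd_eq_one.2 ⟨h2, hpow g hg⟩
    rw [((Nat.coprime_primes Nat.prime_two hp).2 hp2.symm).gcd_eq_one, pow_one] at h1
    exact hg1 h1
  have huse : ∀ {ζ : Kˣ} {z : Kˣ} (hζ : IsPrimitiveRoot ζ p) (σ : Equiv.Perm (Fin 3)) (k : ℕ) (s : Kˣ),
      (∀ i, u (σ i) ^ k = s * ![1, ζ, z] i) →
      IsConjSubgroup H (Subgroup.closure {diag 1 ζ z}) := fun hζ σ k s h =>
    isConjSubgroup_of_pow_perm hp.ne_zero hcard hζ hg hu σ k s h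
  obtain ⟨ζ, hζ'⟩ := HasEnoughRootsOfUnity.exists_primitiveRoot K p
  obtain ⟨ζ, rfl⟩ := hζ'.isUnit hp.ne_zero
  have hζ := IsPrimitiveRoot.coe_units_iff.1 hζ'
  obtain ⟨e, he⟩ := exists_zmod_exponents hζ hup
  obtain ⟨hrig', hinj⟩ := exponents_rigid_injective hζ hrig hne he
  by_cases h0 : ∃ i, e i = 0
  · obtain ⟨i, hi⟩ := h0
    obtain ⟨σ, rfl⟩ := exists_perm_apply_zero i
    obtain rfl := (hrig'.perm σ).eq_three (e := e ∘ σ) (hinj.comp σ.injective) hi hp2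
    obtain ⟨e, he⟩ := exists_zmod_exponents h₃ hup
    obtain ⟨-, hinj⟩ := exponents_rigid_injective h₃ hrig hne he
    obtain ⟨τ, hτ⟩ := exists_perm_zmod_three e hinj
    refine Or.inl (huse h₃ τ 1 1 fun i => ?_)
    have h2 : u (τ i) ^ 1 = ζ₃ ^ (i : ℕ) := by
      rw [pow_one, he, pow_eq_pow_iff_natCast_zmod h₃, hτ]
      simp
    rw [h2]
    fin_cases i <;> simp
  · push Not at h0
    obtain ⟨h57, -⟩ := hrig'.eq_five_or_seven hinj h0 hp2
    -- A suitable power of the generator has exponents `1, 2, 4`, that is, `0, 1, 3` up to a scalar.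
    have hexp : ∀ {ζ : Kˣ}, IsPrimitiveRoot ζ p → ∃ (σ : Equiv.Perm (Fin 3)) (k : ℕ),
        ∀ i, u (σ i) ^ k = ζ * ![1, ζ, ζ ^ 3] i := by
      intro ζ hζ
      obtain ⟨e, he⟩ := exists_zmod_exponents hζ hup
      obtain ⟨hrig', hinj⟩ := exponents_rigid_injective hζ hrig hne he
      have h0 : ∀ i, e i ≠ 0 := fun i hi => by
        obtain ⟨σ, rfl⟩ := exists_perm_apply_zero i
        have h3 := (hrig'.perm σ).eq_three (e := e ∘ σ) (hinj.comp σ.injective) hi hp2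
        omega
      obtain ⟨-, σ, h1, h2⟩ := hrig'.eq_five_or_seven hinj h0 hp2
      refine ⟨σ, (e (σ 0))⁻¹.val, fun i => ?_⟩
      have h00 := h0 (σ 0)
      rw [he, ← pow_mul]
      fin_cases i
      · suffices ζ ^ ((e (σ 0)).val * (e (σ 0))⁻¹.val) = ζ ^ 1 by simpa using this
        rw [pow_eq_pow_iff_natCast_zmod hζ]
        simp [h00]
      · suffices ζ ^ ((e (σ 1)).val * (e (σ 0))⁻¹.val) = ζ ^ 2 by simpa [pow_succ] using this
        rw [pow_eq_pow_iff_natCast_zmod hζ]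
        simp [h00, h1]
      · suffices ζ ^ ((e (σ 2)).val * (e (σ 0))⁻¹.val) = ζ ^ 4 by
          simpa [← pow_succ'] using this
        rw [pow_eq_pow_iff_natCast_zmod hζ]
        simp [h00, h2]
    rcases h57 with rfl | rfl
    · obtain ⟨σ, k, h⟩ := hexp h₅
      exact Or.inr (Or.inr (Or.inl (huse h₅ σ k _ h)))
    · obtain ⟨σ, k, h⟩ := hexp h₇
      exact Or.inr (Or.inr (Or.inr (Or.inl (huse h₇ σ k _ h))))

lemma isConjToListed_of_card_eq_four (h₄ : IsPrimitiveRoot ζ₄ 4) (hdom : IsDominant f)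
    (hfin : Finite (Aut f)) (hH : H ≤ Aut f) (hcard : Nat.card H = 4) :
    IsConjToListed ζ₃ ζ₄ ζ₅ ζ₇ H := by
  have hpow : ∀ h ∈ H, h ^ 4 = 1 := fun h hh => by
    have := pow_card_eq_one' (x := (⟨h, hh⟩ : H))
    rw [hcard] at this
    exact congrArg Subtype.val this
  by_cases hsq : ∀ h ∈ H, h ^ 2 = 1
  · obtain ⟨φ, hφ⟩ := exists_diagonalization hdom hfin hH two_ne_zero hsq fun g hg h hh =>
      congrArg Subtype.val (Commute.of_orderOf_dvd_two (G := H)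
        (fun x => orderOf_dvd_of_pow_eq_one (Subtype.ext (hsq x x.2))) ⟨g, hg⟩ ⟨h, hh⟩).eq
    exact Or.inr (Or.inr (Or.inr (Or.inr (isConjSubgroup_klein hcard fun g hg =>
      (hφ g hg).imp fun u h => ⟨h.1, h.2.1⟩))))
  · push Not at hsq
    obtain ⟨g, hg, hg2⟩ := hsq
    have hle : Subgroup.zpowers g ≤ H := by rwa [Subgroup.zpowers_le]
    obtain ⟨φ, hφ⟩ := exists_diagonalization hdom hfin (hle.trans hH) four_ne_zero
      (fun h hh => hpow h (hle hh)) (fun a ha b hb => by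
        obtain ⟨k, rfl⟩ := ha
        obtain ⟨l, rfl⟩ := hb
        exact (Commute.zpow_zpow_self g k l).eq)
    obtain ⟨u, hu, hup, hrig⟩ := hφ g (Subgroup.mem_zpowers g)
    have hne : Matrix.ProjGenLinGroup.mk (diagGL 3 K u) ^ 2 ≠ 1 := by
      rw [← hu, conj_pow]
      rwa [Ne, conj_eq_one_iff]
    obtain ⟨e, he⟩ := exists_zmod_exponents h₄ hup
    obtain ⟨-, hinj⟩ := exponents_rigid_injective h₄ hrig hne he
    obtain ⟨σ, m, hσ⟩ := exists_perm_zmod_four e hinj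
    have hneg : ζ₄ ^ 2 = -1 := by
      have h1 : (ζ₄ ^ 2) ^ 2 = 1 := by rw [← pow_mul, h₄.pow_eq_one]
      exact (units_eq_one_or_neg_one h1).resolve_left
        (h₄.pow_ne_one_of_pos_of_lt two_ne_zero (by norm_num))
    refine Or.inr (Or.inl (isConjSubgroup_of_pow_perm four_ne_zero hcard h₄ hg hu σ 1
      (ζ₄ ^ m.val) fun i => ?_))
    have h2 : u (σ i) ^ 1 = ζ₄ ^ m.val * ζ₄ ^ (i : ℕ) := by
      rw [pow_one, he, ← pow_add, pow_eq_pow_iff_natCast_zmod h₄, hσ]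
      simp
    rw [h2]
    fin_cases i <;> simp [hneg]

end Classification

/-! ### Existence of small subgroups -/

lemma exists_subgroup_card_four_or_odd_prime {G : Type*} [Group G] [Finite G] (h : 3 ≤ Nat.card G) :
    ∃ H : Subgroup G, Nat.card H = 4 ∨ (Nat.card H).Prime ∧ Odd (Nat.card H) := by
  rcases Nat.eq_two_pow_or_exists_odd_prime_and_dvd (Nat.card G) with ⟨k, hk⟩ | ⟨p, hp, hdvd, hodd⟩
  · have hk2 : 2 ≤ k := by
      by_contra! hlt
      interval_cases k <;> lia
    have : Fact (Nat.Prime 2) := ⟨Nat.prime_two⟩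
    obtain ⟨H, hH⟩ := Sylow.exists_subgroup_card_pow_prime (G := G) 2 (hk ▸ pow_dvd_pow 2 hk2)
    exact ⟨H, Or.inl hH⟩
  · have : Fact p.Prime := ⟨hp⟩
    obtain ⟨H, hH⟩ := Sylow.exists_subgroup_card_pow_prime (G := G) p (n := 1) (by simpa using hdvd)
    rw [pow_one] at hH
    exact ⟨H, Or.inr (hH ▸ ⟨hp, hodd⟩)⟩

end RationalMap
end

theorem theorem1 {K : Type*} [Field K] [IsAlgClosed K] [CharZero K]
    (ζ₃ ζ₄ ζ₅ ζ₇ : Kˣ) (h₃ : IsPrimitiveRoot ζ₃ 3) (h₄ : IsPrimitiveRoot ζ₄ 4)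
    (h₅ : IsPrimitiveRoot ζ₅ 5) (h₇ : IsPrimitiveRoot ζ₇ 7)
    (G : Subgroup (Matrix.ProjGenLinGroup (Fin 3) K)) (hfin : Finite G) (hG : 3 ≤ Nat.card G)
    (hf : ∃ f ∈ RationalMap.RatWithSS 3 2 G,
      RationalMap.IsDominant f ∧ RationalMap.HasDegree f 2 ∧ Finite (RationalMap.Aut f)) :
    (∃ H ≤ G, RationalMap.IsConjToListed ζ₃ ζ₄ ζ₅ ζ₇ H) ∧
    (∀ H ≤ G, (Nat.card H = 4 ∨ (Nat.card H).Prime ∧ Odd (Nat.card H)) →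
      RationalMap.IsConjToListed ζ₃ ζ₄ ζ₅ ζ₇ H) := by
  obtain ⟨f, ⟨hGf, -⟩, hdom, -, hAut⟩ := hf
  have key : ∀ H ≤ G, (Nat.card H = 4 ∨ (Nat.card H).Prime ∧ Odd (Nat.card H)) →
      RationalMap.IsConjToListed ζ₃ ζ₄ ζ₅ ζ₇ H := by
    rintro H hH (h4 | ⟨hp, hodd⟩)
    · exact RationalMap.isConjToListed_of_card_eq_four h₄ hdom hAut (hH.trans hGf) h4
    · exact RationalMap.isConjToListed_of_card_eq_prime h₃ h₅ h₇ hdom hAut (hH.trans hGf) hp hodd rfl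
  obtain ⟨H, hH⟩ := RationalMap.exists_subgroup_card_four_or_odd_prime hG
  have hle : H.map G.subtype ≤ G := Subgroup.map_subtype_le H
  refine ⟨⟨_, hle, key _ hle ?_⟩, key⟩
  rwa [Subgroup.card_map_of_injective G.subtype_injective]
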